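/- Let $h\in\mathbb{C}\setminus\{0\}$, let $\mathcal{M}(\mathbb{C})$ be the field of meromorphic functions on $\mathbb{C}$, and let $\rho$ be its automorphism $(\rho y)(x)=y(x+h)$. Call $f\in\mathcal{M}(\mathbb{C})$ differentially algebraic over $\mathbb{C}(x)$ if there are $m\in\mathbb{N}$ and a nonzero polynomial $P\in\mathbb{C}(x)[X_0,\dots,X_m]$ with $P(f,\partial_x f,\dots,\partial_x^m f)=0$. For $\omega\in\mathbb{C}$ let $C_\omega=\{g\in\mathcal{M}(\mathbb{C}) : g(x+\omega)=g(x)\}$, let $C_h^\infty=\bigcup_{\ell\ge 1}C_{\ell h}$, let $C_h^\infty(x)\subset\mathcal{M}(\mathbb{C})$ be the subfield generated by $C_h^\infty$ and $x$, and let $R_{h,\exp}\subset\mathcal{M}(\mathbb{C})$ be the ring of finite $C_h^\infty(x)$-linear combinations of the functions $e^{\lambda x}$, $\lambda\in\mathbb{C}$. Let $0\neq a\in\mathbb{C}(x)$. If $f\in\mathcal{M}(\mathbb{C})$ satisfies $\rho(f)=af$ and is differentially algebraic over $\mathbb{C}(x)$, then there exist $c_1\in C_h$, $d\in\mathbb{C}(x)$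 and $c'\in\mathbb{C}$ such that $$f(x)=c_1(x)\,d(x)\,e^{c'x};$$ in particular $f\in R_{h,\exp}$. -/

import Mathlib

open Filter Topology

noncomputable section

namespace MeroShift

/-! ### The field of meromorphic functions on the complex plane -/

/-- The ring of meromorphic functions on `ℂ`. A meromorphic function is represented by a function
`f : ℂ → ℂ` that is meromorphic at every point, and two representatives are identified when they
agree outside a closed discrete set (so the values given to `f` at its poles play no role). -/
def meroSubring : Subring (Germ (codiscrete ℂ) ℂ) where
  carrier := {φ | ∃ f : ℂ → ℂ, Meromorphic f ∧ (f : Germ (codiscrete ℂ) ℂ) = φ}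
  mul_mem' := by
    rintro _ _ ⟨f, hf, rfl⟩ ⟨g, hg, rfl⟩
    exact ⟨f * g, hf.mul hg, rfl⟩
  one_mem' := ⟨1, Meromorphic.const 1, rfl⟩
  add_mem' := by
    rintro _ _ ⟨f, hf, rfl⟩ ⟨g, hg, rfl⟩
    exact ⟨f + g, hf.add hg, rfl⟩
  zero_mem' := ⟨0, Meromorphic.const 0, rfl⟩
  neg_mem' := by
    rintro _ ⟨f, hf, rfl⟩
    exact ⟨-f, hf.neg, rfl⟩

/-- The type `ℳ(ℂ)` of meromorphic functions on `ℂ`. -/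
abbrev Mero : Type := ↥meroSubring

/-- The element of `ℳ(ℂ)` represented by a function that is meromorphic on `ℂ`. -/
def Mero.mk (f : ℂ → ℂ) (hf : Meromorphic f) : Mero := ⟨(f : Germ (codiscrete ℂ) ℂ), f, hf, rfl⟩

theorem Mero.ind {p : Mero → Prop} (H : ∀ f hf, p (Mero.mk f hf)) (x : Mero) : p x := by
  obtain ⟨_, f, hf, rfl⟩ := x
  exact H f hf

theorem Mero.mk_eq_mk {f g : ℂ → ℂ} {hf : Meromorphic f} {hg : Meromorphic g} :
    Mero.mk f hf = Mero.mk g hg ↔ f =ᶠ[codiscrete ℂ] g :=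
  ⟨fun e => Germ.coe_eq.1 (congrArg Subtype.val e), fun e => Subtype.ext (Germ.coe_eq.2 e)⟩

/-- A meromorphic function on the plane either vanishes identically or has discrete zeros. -/
theorem eventually_ne_zero {f : ℂ → ℂ} (hf : Meromorphic f) (h : ¬ f =ᶠ[codiscrete ℂ] 0) :
    ∀ᶠ z in codiscrete ℂ, f z ≠ 0 := by
  have hU : MeromorphicOn f Set.univ := meromorphicOn_univ.2 hf
  by_cases hx : ∃ u : (Set.univ : Set ℂ), meromorphicOrderAt f u ≠ ⊤
  · have := (hU.exists_meromorphicOrderAt_ne_top_iff_forall isConnected_univ).1 hx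
    exact hU.eventually_codiscreteWithin_apply_ne_zero fun x hx => this ⟨x, hx⟩
  · exfalso
    push Not at hx
    apply h
    change {z | f z = (0 : ℂ → ℂ) z} ∈ codiscreteWithin (Set.univ : Set ℂ)
    rw [mem_codiscreteWithin_iff_forall_mem_nhdsNE]
    intro x _
    filter_upwards [meromorphicOrderAt_eq_top_iff.1 (hx ⟨x, Set.mem_univ x⟩)] with z hz
    exact Or.inl hz

instance codiscrete_neBot : NeBot (codiscrete ℂ) := by
  refine ⟨fun h => ?_⟩
  have h0 : (∅ : Set ℂ) ∈ codiscreteWithin (Set.univ : Set ℂ) := by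
    change ∅ ∈ codiscrete ℂ
    rw [h]; exact mem_bot
  rw [mem_codiscreteWithin_iff_forall_mem_nhdsNE] at h0
  have h1 := h0 0 (Set.mem_univ _)
  simp only [Set.compl_univ, Set.union_empty] at h1
  exact (NeBot.ne inferInstance : 𝓝[≠] (0 : ℂ) ≠ ⊥) (empty_mem_iff_bot.1 h1)

instance : Inv Mero where
  inv x := ⟨(x : Germ (codiscrete ℂ) ℂ)⁻¹, by
    obtain ⟨_, f, hf, rfl⟩ := x
    exact ⟨f⁻¹, hf.inv, rfl⟩⟩

/-- `ℳ(ℂ)` is a field. -/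
instance : Field Mero where
  inv := Inv.inv
  exists_pair_ne := ⟨0, 1, zero_ne_one⟩
  mul_inv_cancel := by
    intro x
    induction x using Mero.ind with
    | H f hf =>
      intro hx
      have hne : ¬ f =ᶠ[codiscrete ℂ] 0 := fun h0 => hx (Subtype.ext (Germ.coe_eq.2 h0))
      refine Subtype.ext (Germ.coe_eq.2 ?_)
      filter_upwards [eventually_ne_zero hf hne] with z hz
      exact mul_inv_cancel₀ hz
  inv_zero := by
    refine Subtype.ext (Germ.coe_eq.2 (Eventually.of_forall fun z => ?_))
    exact inv_zero
  nnqsmul := _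
  nnqsmul_def := fun _ _ => rfl
  qsmul := _
  qsmul_def := fun _ _ => rfl

/-! ### The shift `ρ` and the derivation `∂ₓ` -/

theorem tendsto_add_codiscrete (h : ℂ) :
    Tendsto (fun z : ℂ => z + h) (codiscrete ℂ) (codiscrete ℂ) := by
  intro s hs
  change s ∈ codiscreteWithin (Set.univ : Set ℂ) at hs
  change (fun z : ℂ => z + h) ⁻¹' s ∈ codiscreteWithin (Set.univ : Set ℂ)
  rw [mem_codiscreteWithin_iff_forall_mem_nhdsNE] at hs ⊢
  intro x _
  have hx := hs (x + h) (Set.mem_univ _)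
  simp only [Set.compl_univ, Set.union_empty] at hx ⊢
  have ht : Tendsto (fun z : ℂ => z + h) (𝓝[≠] x) (𝓝[≠] (x + h)) := by
    refine tendsto_nhdsWithin_iff.2 ⟨?_, ?_⟩
    · exact ((continuous_id.add continuous_const).tendsto x).mono_left nhdsWithin_le_nhds
    · filter_upwards [self_mem_nhdsWithin] with z hz
      simpa using hz
  exact ht hx

/-- The shift `ρ : y(x) ↦ y(x + h)` on `ℳ(ℂ)`. -/
def shift (h : ℂ) : Mero →+* Mero where
  toFun x := ⟨(x : Germ (codiscrete ℂ) ℂ).compTendsto _ (tendsto_add_codiscrete h), by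
    obtain ⟨_, f, hf, rfl⟩ := x
    exact ⟨f ∘ (· + h), Meromorphic.meromorphic_comp_add_const_iff_meromorphic.2 hf, rfl⟩⟩
  map_one' := rfl
  map_zero' := rfl
  map_mul' x y := by
    induction x using Mero.ind with
    | H f hf => induction y using Mero.ind with | H g hg => rfl
  map_add' x y := by
    induction x using Mero.ind with
    | H f hf => induction y using Mero.ind with | H g hg => rfl

theorem shift_mk (h : ℂ) (f : ℂ → ℂ) (hf : Meromorphic f) :
    shift h (Mero.mk f hf) = Mero.mk (fun z => f (z + h))
      (Meromorphic.meromorphic_comp_add_const_iff_meromorphic.2 hf) := rfl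

theorem deriv_eventuallyEq {f g : ℂ → ℂ} (h : f =ᶠ[codiscrete ℂ] g) :
    deriv f =ᶠ[codiscrete ℂ] deriv g := by
  have ho : IsOpen {z | f z = g z} := (mem_codiscrete'.1 h).1
  filter_upwards [h] with z hz
  exact EventuallyEq.deriv_eq (ho.mem_nhds hz)

theorem eventually_differentiableAt {f : ℂ → ℂ} (hf : Meromorphic f) :
    ∀ᶠ z in codiscrete ℂ, DifferentiableAt ℂ f z := by
  filter_upwards [(meromorphicOn_univ.2 hf).analyticAt_mem_codiscreteWithin] with z hz
  exact AnalyticAt.differentiableAt hz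

/-- The additive map underlying the derivation `∂ₓ`. -/
def derivAddHom : Mero →+ Mero where
  toFun x := ⟨(x : Germ (codiscrete ℂ) ℂ).map' deriv fun _ _ => deriv_eventuallyEq, by
    obtain ⟨_, f, hf, rfl⟩ := x
    exact ⟨deriv f, hf.deriv, rfl⟩⟩
  map_zero' := by
    refine Subtype.ext (Germ.coe_eq.2 (Eventually.of_forall fun z => ?_))
    exact deriv_const z (0 : ℂ)
  map_add' x y := by
    induction x using Mero.ind with
    | H f hf =>
      induction y using Mero.ind with
      | H g hg =>
        refine Subtype.ext (Germ.coe_eq.2 ?_)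
        filter_upwards [eventually_differentiableAt hf, eventually_differentiableAt hg]
          with z h1 h2
        exact deriv_add h1 h2

/-- The derivation `∂ₓ` of `ℳ(ℂ)`. -/
def D : Derivation ℤ Mero Mero :=
  Derivation.mk' derivAddHom.toIntLinearMap (by
    intro x y
    induction x using Mero.ind with
    | H f hf =>
      induction y using Mero.ind with
      | H g hg =>
        refine Subtype.ext (Germ.coe_eq.2 ?_)
        filter_upwards [eventually_differentiableAt hf, eventually_differentiableAt hg]
          with z h1 h2
        refine (deriv_mul h1 h2).trans ?_
        change _ = f z * deriv g z + g z * deriv f z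
        ring)

theorem D_mk (f : ℂ → ℂ) (hf : Meromorphic f) :
    D (Mero.mk f hf) = Mero.mk (deriv f) hf.deriv := rfl

/-! ### Rational functions and exponentials inside `ℳ(ℂ)` -/

theorem meromorphic_polynomial (p : Polynomial ℂ) : Meromorphic fun z => p.eval z :=
  fun z => (p.differentiable.analyticAt z).meromorphicAt

/-- A polynomial, seen as a meromorphic function. -/
def polyHom : Polynomial ℂ →+* Mero where
  toFun p := Mero.mk (fun z => p.eval z) (meromorphic_polynomial p)
  map_one' := Subtype.ext (Germ.coe_eq.2 (Eventually.of_forall fun _ => Polynomial.eval_one))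
  map_zero' := Subtype.ext (Germ.coe_eq.2 (Eventually.of_forall fun _ => Polynomial.eval_zero))
  map_mul' p q := Subtype.ext (Germ.coe_eq.2 (Eventually.of_forall fun _ => Polynomial.eval_mul))
  map_add' p q := Subtype.ext (Germ.coe_eq.2 (Eventually.of_forall fun _ => Polynomial.eval_add))

theorem polyHom_injective : Function.Injective polyHom := by
  rw [injective_iff_map_eq_zero]
  intro p hp
  by_contra hne
  have h1 : ∀ᶠ z in codiscrete ℂ, p.eval z = 0 :=
    Germ.coe_eq.1 (congrArg Subtype.val hp)
  have h2 : {z | p.IsRoot z}ᶜ ∈ codiscrete ℂ :=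
    (Polynomial.finite_setOfPred_isRoot hne).compl_mem_codiscrete
  obtain ⟨z, hz, hz'⟩ := (h1.and h2).exists
  exact hz' hz

/-- The embedding `ℂ(x) → ℳ(ℂ)`. -/
def ratHom : RatFunc ℂ →+* Mero :=
  RatFunc.liftRingHom polyHom
    (nonZeroDivisors_le_comap_nonZeroDivisors_of_injective polyHom polyHom_injective)

/-- `ℳ(ℂ)` is an extension of the field `ℂ(x)` of rational functions. -/
instance : Algebra (RatFunc ℂ) Mero := ratHom.toAlgebra

/-- The function `x ↦ x`. -/
def xM : Mero := Mero.mk (fun z => z) fun z => MeromorphicAt.id z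

/-- The function `x ↦ exp (c x)`. -/
def expM (c : ℂ) : Mero :=
  Mero.mk (fun z => Complex.exp (c * z)) fun z =>
    (((differentiable_id.const_mul c).cexp).analyticAt z).meromorphicAt

/-! ### Differentially algebraic functions, periodic functions, the ring `R_{h,exp}` -/

/-- `f` is differentially algebraic over `ℂ(x)`: there are `m` and a nonzero polynomial
`P ∈ ℂ(x)[X₀, …, X_m]` with `P(f, ∂ₓ f, …, ∂ₓ^m f) = 0`. -/
def IsDiffAlgebraic (f : Mero) : Prop :=
  ∃ (m : ℕ) (P : MvPolynomial (Fin (m + 1)) (RatFunc ℂ)), P ≠ 0 ∧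
    MvPolynomial.aeval (fun i : Fin (m + 1) => D^[(i : ℕ)] f) P = 0

/-- The field `C_h` of `h`-periodic meromorphic functions. -/
def periodic (h : ℂ) : Subfield Mero := RingHom.eqLocusField (shift h) (RingHom.id Mero)

/-- `C_h^∞`, the union of the fields `C_{ℓ h}` over the integers `ℓ ≥ 1`. -/
def periodicUnion (h : ℂ) : Set Mero := ⋃ (ℓ : ℕ) (_ : 1 ≤ ℓ), (periodic (ℓ * h) : Set Mero)

/-- `C_h^∞(x)`, the subfield of `ℳ(ℂ)` generated by `C_h^∞` and `x`. -/
def periodicRat (h : ℂ) : Subfield Mero := Subfield.closure (periodicUnion h ∪ {xM})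

theorem expM_zero : expM 0 = 1 := by
  refine Subtype.ext (Germ.coe_eq.2 (Eventually.of_forall fun z => ?_))
  change Complex.exp (0 * z) = 1
  rw [zero_mul, Complex.exp_zero]

theorem expM_add (c d : ℂ) : expM (c + d) = expM c * expM d := by
  refine Subtype.ext (Germ.coe_eq.2 (Eventually.of_forall fun z => ?_))
  change Complex.exp ((c + d) * z) = Complex.exp (c * z) * Complex.exp (d * z)
  rw [add_mul, Complex.exp_add]

/-- The ring `R_{h,exp}` of the `C_h^∞(x)`-linear combinations of the functions `exp (c x)`,
`c ∈ ℂ`. -/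
def Rexp (h : ℂ) : Subring Mero where
  carrier := Submodule.span (periodicRat h) (Set.range expM)
  zero_mem' := Submodule.zero_mem _
  one_mem' := Submodule.subset_span ⟨0, expM_zero⟩
  add_mem' := Submodule.add_mem _
  neg_mem' := Submodule.neg_mem _
  mul_mem' := by
    intro x y hx hy
    have := Submodule.mul_mem_mul hx hy
    rw [Submodule.span_mul_span] at this
    refine Submodule.span_mono ?_ this
    rintro _ ⟨_, ⟨c, rfl⟩, _, ⟨d, rfl⟩, rfl⟩
    exact ⟨c + d, expM_add c d⟩

end MeroShift

end

/-!
Let `ρ` be the shift by `h`, let `b = a' / a`, and suppose `f ≠ 0`. The proof reduces the theorem to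
a statement about poles of rational functions.

*From `f` to its logarithmic derivative.* The function `g = f' / f` satisfies the additive equation
`ρ(g) = g + b`, hence `ρ(g⁽ⁱ⁾) = g⁽ⁱ⁾ + b⁽ⁱ⁾` for all `i`. If `f` is differentially algebraic, the
elements algebraic over the field generated by finitely many derivatives of `f` form a differential
field of finite transcendence degree over `ℂ(x)`, so `g, g', …` are algebraically dependent
(`not_algebraicIndependent_logDeriv`).

*From an algebraic relation to a linear one.* The ideal of relations between `g, …, g⁽ᵏ⁻¹⁾` is
stable under the substitution `Xᵢ ↦ Xᵢ + b⁽ⁱ⁾` combined with `ρ` on coefficients. A monic relation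
with least leading monomial is fixed by this substitution (`MvPolynomial.exists_translate_eq_self`), and
among the nonconstant fixed polynomials one of least degree is affine, since partial derivatives of
fixed polynomials are fixed (`MvPolynomial.exists_sum_eq_of_translate_eq_self`). As the only
`h`-periodic rational functions are constants, this yields `∑ cᵢ b⁽ⁱ⁾ = ρ(e) - e` with `e ∈ ℂ(x)`
and `cᵢ ∈ ℂ` not all zero.

*Poles.* Every nonzero `a` is a constant times `ρ(d) / d` times a product of powers of linear
factors whose roots are pairwise incongruent modulo `ℤh` (`HasOrbitForm`). If a factor `(x - α) ^ n`
with `n ≠ 0` were present, `∑ cᵢ b⁽ⁱ⁾` would, up to a term of the form `ρ(e') - e'`, have exactly one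
pole in the orbit `α + ℤh`; but a difference `ρ(e) - e` of rational functions never does
(`regularAt_shift_sub`). So `a = c₀ ρ(d) / d` with a constant `c₀`, and dividing `f` by
`d exp(c' x)`, where `exp(c' h) = c₀`, leaves an `h`-periodic function.
-/

/-! ### Invariant polynomials under a semilinear translation -/

namespace MvPolynomial

open scoped MonomialOrder

variable {ι K : Type*} [Field K]

/-- In characteristic zero, a polynomial all of whose partial derivatives vanish is constant. -/
theorem eq_C_of_forall_pderiv_eq_zero [CharZero K] {P : MvPolynomial ι K}
    (h : ∀ i, pderiv i P = 0) : P = C (coeff 0 P) := by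
  classical
  ext e
  rw [coeff_C]
  split_ifs with he
  · rw [he]
  · obtain ⟨i, hi⟩ : ∃ i, e i ≠ 0 := by
      by_contra! hc
      exact he (Finsupp.ext fun i => (hc i).symm)
    have h1 := congrArg (coeff (e - Finsupp.single i 1)) (h i)
    have h2 : e - Finsupp.single i 1 + Finsupp.single i 1 = e := by
      ext j
      by_cases hj : i = j
      · subst hj; simp; omega
      · simp [hj]
    rw [coeff_pderiv, h2, coeff_zero] at h1
    exact (mul_eq_zero.1 h1).resolve_right (Nat.cast_add_one_ne_zero _)

theorem totalDegree_pderiv_lt {P : MvPolynomial ι K} (hP : 0 < P.totalDegree) (i : ι) :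
    (pderiv i P).totalDegree < P.totalDegree := by
  refine (Finset.sup_lt_iff hP).2 fun e he => ?_
  rw [mem_support_iff, coeff_pderiv] at he
  have h1 := le_totalDegree (mem_support_iff.2 (left_ne_zero_of_mul he))
  rw [Finsupp.sum_add_index' (fun _ => rfl) (fun _ _ _ => rfl), Finsupp.sum_single_index rfl] at h1
  exact h1

/-- The semilinear substitution `Xᵢ ↦ Xᵢ + βᵢ` acting through `τ` on the coefficients. -/
noncomputable def translate (τ : K →+* K) (β : ι → K) : MvPolynomial ι K →+* MvPolynomial ι K :=
  eval₂Hom (C.comp τ) fun i => X i + C (β i)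

variable (τ : K →+* K) (β : ι → K)

@[simp]
theorem translate_C (c : K) : translate τ β (C c) = C (τ c) := by
  simp [translate]

@[simp]
theorem translate_X (i : ι) : translate τ β (X i) = X i + C (β i) := by
  simp [translate]

theorem pderiv_translate (P : MvPolynomial ι K) (i : ι) :
    pderiv i (translate τ β P) = translate τ β (pderiv i P) := by
  classical
  induction P using MvPolynomial.induction_on with
  | C c => simp
  | add p q hp hq => simp [hp, hq]
  | mul_X p j hp =>
    have hX : pderiv i (X j : MvPolynomial ι K) = translate τ β (pderiv i (X j)) := by
      rcases eq_or_ne j i with rfl | hij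
      · simp
      · simp [pderiv_X_of_ne hij]
    rw [map_mul, translate_X, pderiv_mul, hp, map_add (pderiv i), pderiv_C, add_zero, hX,
      pderiv_mul, map_add, map_mul, map_mul, translate_X]

theorem aeval_translate {M : Type*} [Field M] [Algebra K M] {ρ : M →+* M}
    (hρ : ∀ r, ρ (algebraMap K M r) = algebraMap K M (τ r)) {z : ι → M}
    (hz : ∀ i, ρ (z i) = z i + algebraMap K M (β i)) (P : MvPolynomial ι K) :
    aeval z (translate τ β P) = ρ (aeval z P) := by
  induction P using MvPolynomial.induction_on with
  | C c => simp [hρ]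
  | add p q hp hq => simp [hp, hq]
  | mul_X p j hp => simp [hp, hz]

theorem degree_X_add_C (m : MonomialOrder ι) (i : ι) (c : K) :
    m.degree (X i + C c) = Finsupp.single i 1 ∧ m.Monic (X i + C c) := by
  have hlt : m.degree (C c : MvPolynomial ι K) ≺[m] m.degree (X i : MvPolynomial ι K) := by
    rw [m.degree_C, m.degree_X, map_zero]
    refine lt_of_le_of_ne (bot_le (α := m.syn)) fun h => ?_
    simpa using (map_eq_zero_iff m.toSyn m.toSyn.injective).1 h.symm
  refine ⟨?_, ?_⟩
  · rw [m.degree_add_of_lt hlt, m.degree_X]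
  · rw [MonomialOrder.Monic, m.leadingCoeff_add_of_lt hlt, m.leadingCoeff_X]

/-- A translation changes a polynomial only below its leading monomial. -/
theorem coeff_translate_of_degree_le (m : MonomialOrder ι) {P : MvPolynomial ι K} {d : ι →₀ ℕ}
    (hd : m.degree P ≼[m] d) : coeff d (translate τ β P) = τ (coeff d P) := by
  classical
  -- The translate of the monomial `X ^ e` is monic with leading monomial `X ^ e`.
  have key : ∀ e : ι →₀ ℕ,
      m.degree (e.prod fun i k => (X i + C (β i) : MvPolynomial ι K) ^ k) = e ∧
      coeff e (e.prod fun i k => (X i + C (β i) : MvPolynomial ι K) ^ k) = 1 := by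
    intro e
    have h1 : m.degree (e.prod fun i k => (X i + C (β i) : MvPolynomial ι K) ^ k) = e := by
      rw [Finsupp.prod, m.degree_prod]
      · conv_rhs => rw [← Finsupp.sum_single e]
        refine Finset.sum_congr rfl fun i _ => ?_
        rw [m.degree_pow, (degree_X_add_C m i _).1]
        simp
      · intro i _
        exact pow_ne_zero _ (degree_X_add_C m i _).2.ne_zero
    refine ⟨h1, ?_⟩
    have h2 : m.Monic (e.prod fun i k => (X i + C (β i) : MvPolynomial ι K) ^ k) :=
      MonomialOrder.Monic.prod fun i _ => (degree_X_add_C m i _).2.pow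
    have := h2.coeff_degree
    rwa [h1] at this
  have hexp : translate τ β P = ∑ e ∈ P.support,
      C (τ (coeff e P)) * e.prod fun i k => (X i + C (β i)) ^ k := by
    rw [translate, coe_eval₂Hom, eval₂_eq]
    rfl
  rw [hexp, coeff_sum]
  simp only [coeff_C_mul]
  rw [Finset.sum_eq_single d]
  · rw [(key d).2, mul_one]
  · intro e he hed
    rw [m.coeff_eq_zero_of_lt (f := e.prod _), mul_zero]
    rw [(key e).1]
    refine lt_of_le_of_ne ((m.le_degree he).trans hd) fun h => hed (m.toSyn.injective h)
  · intro hd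
    rw [notMem_support_iff.1 hd]
    simp

theorem degree_translate_le (m : MonomialOrder ι) (P : MvPolynomial ι K) :
    m.degree (translate τ β P) ≼[m] m.degree P := by
  by_contra hlt
  rw [not_le] at hlt
  have h1 := coeff_translate_of_degree_le τ β m hlt.le
  rw [m.coeff_eq_zero_of_lt hlt, map_zero, m.coeff_degree_eq_zero_iff] at h1
  rw [h1, m.degree_zero, map_zero] at hlt
  exact (bot_le (α := m.syn)).not_gt hlt

/-- If a translation-stable ideal of relations is nonzero, a monic member of least leading monomial
is invariant under the translation. -/
theorem exists_translate_eq_self [LinearOrder ι] [WellFoundedGT ι]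
    {M : Type*} [Field M] [Algebra K M] {ρ : M →+* M}
    (hρ : ∀ r, ρ (algebraMap K M r) = algebraMap K M (τ r)) {z : ι → M}
    (hz : ∀ i, ρ (z i) = z i + algebraMap K M (β i)) (hdep : ¬ AlgebraicIndependent K z) :
    ∃ P : MvPolynomial ι K, translate τ β P = P ∧ 0 < P.totalDegree := by
  let m : MonomialOrder ι := MonomialOrder.lex
  let S : Set (MvPolynomial ι K) := {P | P ≠ 0 ∧ aeval z P = 0}
  have hS : S.Nonempty := by
    rw [algebraicIndependent_iff] at hdep
    push Not at hdep
    obtain ⟨P, h1, h2⟩ := hdep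
    exact ⟨P, h2, h1⟩
  have wf : WellFounded fun P Q : MvPolynomial ι K => m.toSyn (m.degree P) < m.toSyn (m.degree Q) :=
    InvImage.wf _ wellFounded_lt
  obtain ⟨P₀, ⟨hP0, hz0⟩, hmin⟩ := wf.has_min S hS
  have hlc : m.leadingCoeff P₀ ≠ 0 := m.leadingCoeff_ne_zero_iff.2 hP0
  set P := (m.leadingCoeff P₀)⁻¹ • P₀ with hP
  have hdeg : m.degree P = m.degree P₀ := m.degree_smul_of_isRegular
    (IsRegular.of_ne_zero (inv_ne_zero hlc))
  have hcoeff : coeff (m.degree P₀) P = 1 := by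
    rw [hP, coeff_smul, smul_eq_mul]
    exact inv_mul_cancel₀ hlc
  have hzP : aeval z P = 0 := by rw [hP, map_smul, hz0, smul_zero]
  have hPne : P ≠ 0 := by
    rintro h
    rw [h] at hcoeff
    simp at hcoeff
  refine ⟨P, ?_, ?_⟩
  -- Both leading terms are `X ^ degree P₀`, so a nonzero difference contradicts minimality.
  · by_contra hne
    have hne' : translate τ β P - P ≠ 0 := sub_ne_zero.2 hne
    refine hmin _ ⟨hne', ?_⟩ ?_
    · rw [map_sub, aeval_translate τ β hρ hz, hzP, map_zero, sub_zero]
    · refine lt_of_le_of_ne ?_ ?_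
      · refine m.degree_sub_le.trans (sup_le ?_ (by rw [hdeg]))
        rw [← hdeg]
        exact degree_translate_le τ β m P
      · intro h
        have h := m.toSyn.injective h
        refine m.coeff_degree_ne_zero_iff.2 hne' ?_
        rw [h, coeff_sub, coeff_translate_of_degree_le τ β m (by rw [hdeg]), hcoeff, map_one,
          sub_self]
  · rw [pos_iff_ne_zero]
    intro h
    rw [totalDegree_eq_zero_iff_eq_C] at h
    rw [h, aeval_C] at hzP
    rw [(map_eq_zero _).1 hzP, C_0] at h
    exact hPne h

/-- A nonconstant translation-invariant polynomial of least degree is affine, because its partial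
derivatives are again invariant. -/
theorem exists_sum_eq_of_translate_eq_self [Fintype ι] [CharZero K]
    (h : ∃ P : MvPolynomial ι K, translate τ β P = P ∧ 0 < P.totalDegree) :
    ∃ (c : ι → K) (e : K), c ≠ 0 ∧ (∀ i, τ (c i) = c i) ∧ ∑ i, c i * β i = e - τ e := by
  classical
  have wf : WellFounded fun P Q : MvPolynomial ι K => P.totalDegree < Q.totalDegree :=
    InvImage.wf _ wellFounded_lt
  obtain ⟨P, ⟨hP, hpos⟩, hmin⟩ :=
    wf.has_min {P : MvPolynomial ι K | translate τ β P = P ∧ 0 < P.totalDegree} h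
  have hder : ∀ i, ∃ c, pderiv i P = C c := by
    intro i
    by_contra! hc
    refine hmin (pderiv i P) ⟨?_, ?_⟩ (totalDegree_pderiv_lt hpos i)
    · rw [← pderiv_translate, hP]
    · rw [pos_iff_ne_zero]
      intro h0
      exact hc _ (totalDegree_eq_zero_iff_eq_C.1 h0)
  choose c hc using hder
  have hinv : ∀ i, τ (c i) = c i := by
    intro i
    apply C_injective ι K
    rw [← translate_C τ β, ← hc, ← pderiv_translate, hP]
  -- `P` minus its linear part has vanishing partial derivatives, so it is constant.
  obtain ⟨e, he⟩ : ∃ e, P - ∑ i, C (c i) * X i = C e := by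
    refine ⟨_, eq_C_of_forall_pderiv_eq_zero fun i => ?_⟩
    rw [map_sub, map_sum, hc, Finset.sum_eq_single i]
    · simp
    · intro j _ hj
      rw [pderiv_C_mul, pderiv_X_of_ne hj, mul_zero]
    · simp
  rw [sub_eq_iff_eq_add] at he
  refine ⟨c, e, ?_, hinv, ?_⟩
  · rintro rfl
    rw [he] at hpos
    simp at hpos
  · rw [he] at hP
    simp only [map_add, map_sum, map_mul, translate_C, translate_X, hinv, mul_add,
      Finset.sum_add_distrib] at hP
    apply C_injective ι K
    simp only [map_sum, map_mul, map_sub]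
    linear_combination hP

end MvPolynomial

/-! ### Algebraic closures of differential fields -/

section DifferentialClosure

open Algebra

variable {K M : Type*} [Field K] [Field M] [Algebra K M] [CharZero M]

/-- The field of elements algebraic over `K(s)` is stable under a derivation `δ` as soon as it
contains the derivatives of `s` and of the elements of `K`: differentiate an equation of least
degree. -/
theorem isAlgebraic_adjoin_derivation (δ : Derivation ℤ M M) {s : Set M}
    (hK : ∀ r : K, ∃ r' : K, δ (algebraMap K M r) = algebraMap K M r')
    (hs : ∀ x ∈ s, IsAlgebraic (adjoin K s) (δ x)) {w : M} (hw : IsAlgebraic (adjoin K s) w) :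
    IsAlgebraic (adjoin K s) (δ w) := by
  have hcoeff : ∀ r ∈ adjoin K s, IsAlgebraic (adjoin K s) (δ r) := by
    intro r hr
    induction hr using Algebra.adjoin_induction with
    | mem x hx => exact hs x hx
    | algebraMap r =>
      obtain ⟨r', hr'⟩ := hK r
      rw [hr']
      exact isAlgebraic_algebraMap (A := M) (algebraMap K (adjoin K s) r')
    | add x y _ _ hx hy => rw [map_add]; exact hx.add hy
    | mul x y hx' hy' hx hy =>
      rw [Derivation.leibniz]
      exact ((isAlgebraic_algebraMap (A := M) (⟨x, hx'⟩ : adjoin K s)).mul hy).add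
        ((isAlgebraic_algebraMap (A := M) (⟨y, hy'⟩ : adjoin K s)).mul hx)
  -- Leibniz: `δ (p(w)) = q + p'(w) δ w`, where `q` collects the derivatives of the coefficients.
  have hδ : ∀ p : Polynomial (adjoin K s), ∃ q, IsAlgebraic (adjoin K s) q ∧
      δ (Polynomial.aeval w p) = q + Polynomial.aeval w p.derivative * δ w := by
    intro p
    induction p using Polynomial.induction_on' with
    | add p q hp hq =>
      obtain ⟨u, hu, hu'⟩ := hp
      obtain ⟨v, hv, hv'⟩ := hq
      refine ⟨u + v, hu.add hv, ?_⟩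
      simp only [map_add, hu', hv']
      ring
    | monomial n r =>
      refine ⟨δ r * w ^ n, (hcoeff r r.2).mul (hw.pow n), ?_⟩
      simp only [Polynomial.aeval_monomial, Polynomial.derivative_monomial, Derivation.leibniz,
        Derivation.leibniz_pow, smul_eq_mul, nsmul_eq_mul, map_mul, map_natCast]
      change (r : M) * _ + w ^ n * δ (r : M) = δ (r : M) * w ^ n + (r : M) * _ * _ * _
      ring
  have wf : WellFounded fun p q : Polynomial (adjoin K s) => p.natDegree < q.natDegree :=
    InvImage.wf _ wellFounded_lt
  obtain ⟨p, ⟨hp0, hpw⟩, hmin⟩ := wf.has_min {p | p ≠ 0 ∧ Polynomial.aeval w p = 0} hw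
  have hinj : Function.Injective (algebraMap (adjoin K s) M) := Subtype.val_injective
  have hdeg : p.natDegree ≠ 0 := by
    intro h
    rw [Polynomial.eq_C_of_natDegree_eq_zero h, Polynomial.aeval_C] at hpw
    rw [Polynomial.eq_C_of_natDegree_eq_zero h] at hp0
    exact hp0 (by rw [(map_eq_zero_iff _ hinj).1 hpw, Polynomial.C_0])
  have : CharZero (adjoin K s) := (RingHom.charZero_iff hinj).2 inferInstance
  have hder : Polynomial.aeval w p.derivative ≠ 0 := by
    intro h
    refine hmin _ ⟨?_, h⟩ (Polynomial.natDegree_derivative_lt hdeg)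
    intro h0
    exact hdeg (Polynomial.derivative_eq_zero.1 h0)
  obtain ⟨q, hq, hq'⟩ := hδ p
  rw [hpw, map_zero] at hq'
  have hval : ∀ p : Polynomial (adjoin K s), IsAlgebraic (adjoin K s) (Polynomial.aeval w p) :=
    fun p => Algebra.adjoin_le (S := Subalgebra.algebraicClosure (adjoin K s) M)
      (Set.singleton_subset_iff.2 hw) (Polynomial.aeval_mem_adjoin_singleton _ w)
  have : δ w = -q * (Polynomial.aeval w p.derivative)⁻¹ := by
    field_simp
    linear_combination -hq'
  rw [this]
  exact hq.neg.mul (hval _).inv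

/-- In a sequence with algebraically dependent initial segments, some term is algebraic over the
preceding ones. -/
theorem exists_isAlgebraic_adjoin_range {R A : Type*} [CommRing R] [CommRing A] [Algebra R A]
    (hinj : Function.Injective (algebraMap R A))
    {n : ℕ} {y : ℕ → A} (h : ¬ AlgebraicIndependent R fun i : Fin n => y i) :
    ∃ k, IsAlgebraic (adjoin R (Set.range fun i : Fin k => y i)) (y k) := by
  induction n with
  | zero => exact absurd (algebraicIndependent_empty_type_iff.2 hinj) h
  | succ n ih =>
    by_cases hn : AlgebraicIndependent R fun i : Fin n => y i
    · refine ⟨n, ?_⟩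
      by_contra htr
      apply h
      have := (hn.option_iff_transcendental (y n)).2 htr
      rw [← algebraicIndependent_equiv finSuccEquivLast.symm]
      convert this using 1
      funext o
      cases o <;> simp
    · exact ih hn

open AlgebraicIndependent in
/-- If the derivatives of a nonzero `f` are algebraically dependent over `K`, so are those of the
logarithmic derivative of `f`: both families live in a differential field of finite transcendence
degree. -/
theorem not_algebraicIndependent_logDeriv (δ : Derivation ℤ M M)
    (hK : ∀ r : K, ∃ r' : K, δ (algebraMap K M r) = algebraMap K M r') {f : M} {n : ℕ}
    (hf : ¬ AlgebraicIndependent K fun i : Fin n => δ^[i] f) :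
    ∃ k, ¬ AlgebraicIndependent K fun i : Fin k => δ^[i] (δ f / f) := by
  obtain ⟨k, hk⟩ := exists_isAlgebraic_adjoin_range (y := fun i => δ^[i] f)
    (algebraMap K M).injective hf
  set s : Set M := Set.range fun i : Fin k => δ^[i] f with hs
  have hgen : ∀ i : ℕ, i ≤ k → IsAlgebraic (adjoin K s) (δ^[i] f) := by
    intro i hi
    rcases hi.lt_or_eq with hi | rfl
    · exact isAlgebraic_algebraMap (A := M) (⟨_, subset_adjoin ⟨⟨i, hi⟩, rfl⟩⟩ : adjoin K s)
    · exact hk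
  have hstable : ∀ w, IsAlgebraic (adjoin K s) w → IsAlgebraic (adjoin K s) (δ w) := by
    intro w hw
    refine isAlgebraic_adjoin_derivation δ hK ?_ hw
    rintro _ ⟨i, rfl⟩
    have := hgen (i + 1) i.2
    rwa [Function.iterate_succ_apply'] at this
  have hf0 : IsAlgebraic (adjoin K s) f := hgen 0 (Nat.zero_le _)
  have hg : ∀ i, IsAlgebraic (adjoin K s) (δ^[i] (δ f / f)) := by
    intro i
    induction i with
    | zero =>
      rw [Function.iterate_zero_apply, div_eq_mul_inv]
      exact (hstable f hf0).mul hf0.inv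
    | succ i ih => rw [Function.iterate_succ_apply']; exact hstable _ ih
  refine ⟨k + 1, fun hind => ?_⟩
  -- The `k + 1` derivatives of `δ f / f` lie in the matroid closure of `k` elements.
  have h1 : (matroid K M).Indep (Set.range fun i : Fin (k + 1) => δ^[i] (δ f / f)) := by
    rw [matroid_indep_iff]
    exact hind.to_subtype_range
  have h2 : (Set.range fun i : Fin (k + 1) => δ^[i] (δ f / f)) ⊆ (matroid K M).closure s := by
    rw [matroid_closure_eq]
    rintro _ ⟨i, rfl⟩
    exact hg i
  have h3 := h1.encard_le_eRk_of_subset h2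
  rw [Matroid.eRk_closure_eq] at h3
  have h4 := h3.trans (Matroid.eRk_le_encard _ _)
  rw [← Set.image_univ, hind.injective.encard_image, hs, ← Set.image_univ] at h4
  have h5 := h4.trans (Set.encard_image_le _ _)
  simp only [Set.encard_univ, ENat.card_eq_coe_fintype_card, Fintype.card_fin] at h5
  have : k + 1 ≤ k := by exact_mod_cast h5
  omega

end DifferentialClosure

/-! ### The field `ℂ(x)` inside `ℳ(ℂ)` -/

namespace MeroShift

open Polynomial

-- The field `ℂ(x)`.
local notation "𝕜" => RatFunc ℂ

theorem shift_polyHom (h : ℂ) (p : ℂ[X]) :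
    shift h (polyHom p) = polyHom (p.comp (X + C h)) := by
  refine Subtype.ext (Germ.coe_eq.2 (Eventually.of_forall fun z => ?_))
  simp

theorem D_polyHom (p : ℂ[X]) : D (polyHom p) = polyHom (derivative p) := by
  refine Subtype.ext (Germ.coe_eq.2 (Eventually.of_forall fun z => ?_))
  exact p.deriv

theorem shift_D (h : ℂ) (φ : Mero) : shift h (D φ) = D (shift h φ) := by
  induction φ using Mero.ind with
  | H f hf =>
    refine Subtype.ext (Germ.coe_eq.2 (Eventually.of_forall fun z => ?_))
    exact (deriv_comp_add_const f h z).symm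

theorem shift_D_iterate (h : ℂ) (i : ℕ) (φ : Mero) : shift h (D^[i] φ) = D^[i] (shift h φ) := by
  induction i generalizing φ with
  | zero => rfl
  | succ i ih => rw [Function.iterate_succ_apply, Function.iterate_succ_apply, ih, shift_D]

theorem shift_neg_shift (h : ℂ) (φ : Mero) : shift (-h) (shift h φ) = φ := by
  induction φ using Mero.ind with
  | H f hf =>
    refine Subtype.ext (Germ.coe_eq.2 (Eventually.of_forall fun z => ?_))
    change f (z + -h + h) = f z
    rw [neg_add_cancel_right]

theorem shift_expM (h c : ℂ) : shift h (expM c) = polyHom (C (Complex.exp (c * h))) * expM c := by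
  refine Subtype.ext (Germ.coe_eq.2 (Eventually.of_forall fun z => ?_))
  change Complex.exp (c * (z + h)) = (C (Complex.exp (c * h))).eval z * Complex.exp (c * z)
  rw [eval_C, mul_add, add_comm, Complex.exp_add]

theorem expM_ne_zero (c : ℂ) : expM c ≠ 0 := by
  intro h0
  have h := expM_add c (-c)
  rw [add_neg_cancel, expM_zero, h0, zero_mul] at h
  exact one_ne_zero h

theorem polyHom_ne_zero {p : ℂ[X]} (hp : p ≠ 0) : polyHom p ≠ 0 :=
  (map_ne_zero_iff _ polyHom_injective).2 hp

theorem algebraMap_algebraMap (p : ℂ[X]) : algebraMap 𝕜 Mero (algebraMap ℂ[X] 𝕜 p) = polyHom p :=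
  RatFunc.liftRingHom_algebraMap ..

theorem exists_eq_div (r : 𝕜) :
    ∃ p q : ℂ[X], q ≠ 0 ∧ algebraMap 𝕜 Mero r = polyHom p / polyHom q := by
  refine ⟨r.num, r.denom, r.denom_ne_zero, ?_⟩
  conv_lhs => rw [← r.num_div_denom]
  rw [map_div₀, algebraMap_algebraMap, algebraMap_algebraMap]

theorem exists_algebraMap_eq_div (p q : ℂ[X]) :
    ∃ r, algebraMap 𝕜 Mero r = polyHom p / polyHom q :=
  ⟨algebraMap ℂ[X] 𝕜 p / algebraMap ℂ[X] 𝕜 q, by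
    rw [map_div₀, algebraMap_algebraMap, algebraMap_algebraMap]⟩

theorem exists_shift_eq (h : ℂ) (r : 𝕜) :
    ∃ r', algebraMap 𝕜 Mero r' = shift h (algebraMap 𝕜 Mero r) := by
  obtain ⟨p, q, -, hr⟩ := exists_eq_div r
  rw [hr, map_div₀, shift_polyHom, shift_polyHom]
  exact exists_algebraMap_eq_div _ _

theorem exists_D_eq (r : 𝕜) : ∃ r', D (algebraMap 𝕜 Mero r) = algebraMap 𝕜 Mero r' := by
  obtain ⟨p, q, -, hr⟩ := exists_eq_div r
  rw [hr]
  obtain ⟨s, hs⟩ := exists_algebraMap_eq_div (derivative p * q - p * derivative q) (q ^ 2)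
  refine ⟨s, ?_⟩
  rw [hs, Derivation.leibniz_div, D_polyHom, D_polyHom]
  simp only [map_sub, map_mul, map_pow, smul_eq_mul]
  ring

/-- The automorphism `x ↦ x + h` of `ℂ(x)`, as the restriction of the shift of `ℳ(ℂ)`. -/
noncomputable def ratShift (h : ℂ) : 𝕜 →+* 𝕜 where
  toFun r := (exists_shift_eq h r).choose
  map_one' := (algebraMap 𝕜 Mero).injective (by
    rw [(exists_shift_eq h _).choose_spec]; simp)
  map_zero' := (algebraMap 𝕜 Mero).injective (by
    rw [(exists_shift_eq h _).choose_spec]; simp)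
  map_mul' r s := (algebraMap 𝕜 Mero).injective (by
    rw [(exists_shift_eq h _).choose_spec, map_mul, map_mul, map_mul,
      (exists_shift_eq h _).choose_spec, (exists_shift_eq h _).choose_spec])
  map_add' r s := (algebraMap 𝕜 Mero).injective (by
    rw [(exists_shift_eq h _).choose_spec, map_add, map_add, map_add,
      (exists_shift_eq h _).choose_spec, (exists_shift_eq h _).choose_spec])

theorem algebraMap_ratShift (h : ℂ) (r : 𝕜) :
    algebraMap 𝕜 Mero (ratShift h r) = shift h (algebraMap 𝕜 Mero r) :=
  (exists_shift_eq h r).choose_spec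

/-! ### Poles of rational functions -/

/-- `φ` is a rational function without a pole at `z`: a quotient of polynomials whose denominator
does not vanish at `z`. -/
def RegularAt (z : ℂ) (φ : Mero) : Prop :=
  ∃ p q : ℂ[X], q.eval z ≠ 0 ∧ φ * polyHom q = polyHom p

namespace RegularAt

variable {z : ℂ} {φ ψ : Mero}

theorem polyHom (z : ℂ) (p : ℂ[X]) : RegularAt z (polyHom p) :=
  ⟨p, 1, by simp, by simp⟩

theorem inv_polyHom {p : ℂ[X]} (hp : p.eval z ≠ 0) : RegularAt z (MeroShift.polyHom p)⁻¹ := by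
  refine ⟨1, p, hp, ?_⟩
  rw [inv_mul_cancel₀ (polyHom_ne_zero (by rintro rfl; simp at hp)), map_one]

theorem add (hφ : RegularAt z φ) (hψ : RegularAt z ψ) : RegularAt z (φ + ψ) := by
  obtain ⟨p, q, hq, h1⟩ := hφ
  obtain ⟨p', q', hq', h2⟩ := hψ
  refine ⟨p * q' + p' * q, q * q', by simp [hq, hq'], ?_⟩
  simp only [map_add, map_mul, ← h1, ← h2]
  ring

theorem mul (hφ : RegularAt z φ) (hψ : RegularAt z ψ) : RegularAt z (φ * ψ) := by
  obtain ⟨p, q, hq, h1⟩ := hφ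
  obtain ⟨p', q', hq', h2⟩ := hψ
  refine ⟨p * p', q * q', by simp [hq, hq'], ?_⟩
  simp only [map_mul, ← h1, ← h2]
  ring

theorem neg (hφ : RegularAt z φ) : RegularAt z (-φ) := by
  obtain ⟨p, q, hq, h1⟩ := hφ
  exact ⟨-p, q, hq, by rw [map_neg, ← h1, neg_mul]⟩

theorem sub (hφ : RegularAt z φ) (hψ : RegularAt z ψ) : RegularAt z (φ - ψ) := by
  rw [sub_eq_add_neg]
  exact hφ.add hψ.neg

theorem sum {ι : Type*} {s : Finset ι} {φ : ι → Mero} (h : ∀ i ∈ s, RegularAt z (φ i)) :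
    RegularAt z (∑ i ∈ s, φ i) := by
  refine Finset.sum_induction φ (RegularAt z) (fun _ _ => add) ?_ h
  simpa using RegularAt.polyHom z 0

theorem D (hφ : RegularAt z φ) : RegularAt z (D φ) := by
  obtain ⟨p, q, hq, h1⟩ := hφ
  refine ⟨derivative p * q - p * derivative q, q ^ 2, by simp [hq], ?_⟩
  have h2 := congrArg MeroShift.D h1
  rw [Derivation.leibniz, D_polyHom, D_polyHom, smul_eq_mul, smul_eq_mul] at h2
  simp only [map_sub, map_mul, map_pow, ← h1, ← h2]
  ring

theorem D_iterate (hφ : RegularAt z φ) (i : ℕ) : RegularAt z (MeroShift.D^[i] φ) := by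
  induction i with
  | zero => exact hφ
  | succ i ih => rw [Function.iterate_succ_apply']; exact ih.D

theorem shift {h : ℂ} (hφ : RegularAt (z + h) φ) : RegularAt z (shift h φ) := by
  obtain ⟨p, q, hq, h1⟩ := hφ
  refine ⟨p.comp (X + C h), q.comp (X + C h), by simpa using hq, ?_⟩
  rw [← shift_polyHom, ← shift_polyHom, ← map_mul, h1]

theorem of_shift {h : ℂ} (hφ : RegularAt z (MeroShift.shift h φ)) : RegularAt (z + h) φ := by
  rw [← shift_neg_shift h φ]
  apply RegularAt.shift
  rwa [add_neg_cancel_right]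

end RegularAt

theorem finite_not_regularAt (r : 𝕜) : {z | ¬ RegularAt z (algebraMap 𝕜 Mero r)}.Finite := by
  obtain ⟨p, q, hq, hr⟩ := exists_eq_div r
  refine (Polynomial.finite_setOfPred_isRoot hq).subset fun z hz => ?_
  by_contra h0
  refine hz ?_
  rw [hr, div_eq_mul_inv]
  exact (RegularAt.polyHom z p).mul (RegularAt.inv_polyHom h0)

/-- A pole of a rational function cannot propagate along an infinite sequence of points. -/
theorem regularAt_of_forall_succ (r : 𝕜) {w : ℕ → ℂ} (hw : Function.Injective w)
    (h : ∀ n, RegularAt (w (n + 1)) (algebraMap 𝕜 Mero r) → RegularAt (w n) (algebraMap 𝕜 Mero r)) :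
    RegularAt (w 0) (algebraMap 𝕜 Mero r) := by
  by_contra h0
  refine Set.infinite_range_of_injective hw ((finite_not_regularAt r).subset ?_)
  rintro _ ⟨n, rfl⟩
  induction n with
  | zero => exact h0
  | succ n ih => exact fun hn => ih (h n hn)

variable {h : ℂ}

/-- If `ρ(r) - r` has no pole at the points `z + nh`, a pole of `r` at `z` would recur at all
`z + nh`. -/
theorem regularAt_of_forall_add (hh : h ≠ 0) {r : 𝕜} {z : ℂ}
    (hr : ∀ n : ℕ, RegularAt (z + n * h)
      (shift h (algebraMap 𝕜 Mero r) - algebraMap 𝕜 Mero r)) :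
    RegularAt z (algebraMap 𝕜 Mero r) := by
  have := regularAt_of_forall_succ r (w := fun n : ℕ => z + n * h) (fun m n hmn => by
    simpa [hh] using hmn) fun n hn => ?_
  · simpa using this
  · have h1 : RegularAt (z + n * h) (shift h (algebraMap 𝕜 Mero r)) := by
      apply RegularAt.shift
      convert hn using 1
      push_cast
      ring
    simpa using h1.sub (hr n)

/-- The analogue of `regularAt_of_forall_add` in the opposite direction. The asymmetry of the index
comes from `ρ(r)` at `z - (n + 1)h` being `r` at `z - nh`. -/
theorem regularAt_of_forall_sub (hh : h ≠ 0) {r : 𝕜} {z : ℂ}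
    (hr : ∀ n : ℕ, RegularAt (z - (n + 1) * h)
      (shift h (algebraMap 𝕜 Mero r) - algebraMap 𝕜 Mero r)) :
    RegularAt z (algebraMap 𝕜 Mero r) := by
  have := regularAt_of_forall_succ r (w := fun n : ℕ => z - n * h) (fun m n hmn => by
    simpa [hh] using hmn) fun n hn => ?_
  · simpa using this
  · have h1 : z - n * h = z - (n + 1) * h + h := by ring
    rw [h1]
    apply RegularAt.of_shift
    push_cast at hn
    simpa using (hr n).add hn

/-- The difference `ρ(r) - r` cannot have exactly one pole in an orbit `α + ℤh`. -/
theorem regularAt_shift_sub (hh : h ≠ 0) {r : 𝕜} {α : ℂ}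
    (hr : ∀ j : ℤ, j ≠ 0 → RegularAt (α + j * h)
      (shift h (algebraMap 𝕜 Mero r) - algebraMap 𝕜 Mero r)) :
    RegularAt α (shift h (algebraMap 𝕜 Mero r) - algebraMap 𝕜 Mero r) := by
  refine RegularAt.sub (RegularAt.shift (regularAt_of_forall_add hh fun n => ?_))
    (regularAt_of_forall_sub hh fun n => ?_)
  · convert hr (n + 1) (by omega) using 1
    push_cast
    ring
  · convert hr (-(n + 1)) (by omega) using 1
    push_cast
    ring

/-- A rational function of period `h ≠ 0` is constant: otherwise the inverse of its difference
with its value at a point would be periodic with a pole. -/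
theorem exists_eq_const_of_shift_eq (hh : h ≠ 0) {r : 𝕜}
    (hr : shift h (algebraMap 𝕜 Mero r) = algebraMap 𝕜 Mero r) :
    ∃ c : ℂ, algebraMap 𝕜 Mero r = polyHom (C c) := by
  have hreg : ∀ s : 𝕜, shift h (algebraMap 𝕜 Mero s) = algebraMap 𝕜 Mero s →
      RegularAt 0 (algebraMap 𝕜 Mero s) := by
    intro s hs
    refine regularAt_of_forall_add hh fun n => ?_
    rw [hs, sub_self]
    simpa using RegularAt.polyHom (0 + n * h) 0
  obtain ⟨p, q, hq, h1⟩ := hreg r hr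
  refine ⟨p.eval 0 / q.eval 0, ?_⟩
  by_contra hne
  set v := p.eval 0 / q.eval 0 with hv
  have hs := hreg (r - algebraMap ℂ[X] 𝕜 (C v))⁻¹ (by
    rw [map_inv₀, map_sub, algebraMap_algebraMap, map_inv₀, map_sub, shift_polyHom, hr, C_comp])
  obtain ⟨p', q', hq', h2⟩ := hs
  rw [map_inv₀, map_sub, algebraMap_algebraMap, inv_mul_eq_iff_eq_mul₀ (sub_ne_zero.2 hne)] at h2
  have h3 : polyHom (q' * q) = polyHom ((p - C v * q) * p') := by
    simp only [map_mul, map_sub, ← h1, h2]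
    ring
  have h4 := congrArg (eval 0) (polyHom_injective h3)
  simp only [eval_mul, eval_sub, eval_C, hv, div_mul_cancel₀ _ hq, sub_self, zero_mul] at h4
  exact mul_ne_zero hq' hq h4

/-- A nonconstant polynomial in `1 / (x - α)` has a pole at `α`. -/
theorem not_regularAt_eval₂ (α : ℂ) {Q : ℂ[X]} (hQ : Q.natDegree ≠ 0) :
    ¬ RegularAt α (Q.eval₂ (polyHom.comp C) (polyHom (X - C α))⁻¹) := by
  rintro ⟨p, q, hq, h1⟩
  have hne : polyHom (X - C α) ≠ 0 := polyHom_ne_zero (X_sub_C_ne_zero α)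
  -- Clear the denominators `(x - α) ^ natDegree Q`; at `α` only the leading coefficient survives.
  have h2 : (X - C α) ^ Q.natDegree * p =
      (∑ i ∈ Finset.range (Q.natDegree + 1),
        C (Q.coeff i) * (X - C α) ^ (Q.natDegree - i)) * q := by
    apply polyHom_injective
    rw [map_mul, ← h1, eval₂_eq_sum_range, map_mul, map_sum, ← mul_assoc, Finset.mul_sum]
    congr 1
    refine Finset.sum_congr rfl fun i hi => ?_
    rw [map_mul, map_pow, map_pow, pow_sub₀ _ hne (Finset.mem_range_succ_iff.1 hi),
      RingHom.comp_apply, inv_pow]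
    ring
  have h3 := congrArg (eval α) h2
  rw [eval_mul, eval_mul, eval_pow, eval_finsetSum, Finset.sum_range_succ,
    Finset.sum_eq_zero] at h3
  · simp [hQ, hq] at h3
    simp [h3] at hQ
  · intro i hi
    have : Q.natDegree - i ≠ 0 := by
      have := Finset.mem_range.1 hi
      omega
    simp [this]

/-! ### Differential operators with constant coefficients -/

theorem D_iterate_inv_X_sub_C (α : ℂ) (i : ℕ) : D^[i] (polyHom (X - C α))⁻¹ =
    polyHom (C ((-1) ^ i * (i.factorial : ℂ))) * (polyHom (X - C α))⁻¹ ^ (i + 1) := by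
  induction i with
  | zero => simp
  | succ i ih =>
    rw [Function.iterate_succ_apply', ih, Derivation.leibniz, Derivation.leibniz_pow,
      Derivation.leibniz_inv, D_polyHom, D_polyHom]
    have h1 : polyHom (C ((-1) ^ (i + 1) * ((i + 1).factorial : ℂ))) =
        -(polyHom (C ((-1) ^ i * (i.factorial : ℂ))) * ((i + 1 : ℕ) : Mero)) := by
      rw [← map_natCast polyHom, ← map_mul, ← map_neg]
      congr 1
      rw [← C_eq_natCast, ← C_mul, ← C_neg, Nat.factorial_succ]
      push_cast
      ring_nf
    rw [h1]
    simp only [derivative_C, map_zero, derivative_sub, derivative_X, sub_zero,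
      map_one, smul_eq_mul, nsmul_eq_mul, Nat.add_sub_cancel]
    ring

/-- The differential operator `∑ᵢ cᵢ Dⁱ` with constant coefficients. -/
noncomputable def constDiffOp {k : ℕ} (c : Fin k → ℂ) : Mero →+ Mero where
  toFun φ := ∑ i, polyHom (C (c i)) * D^[i] φ
  map_zero' := by simp [iterate_map_zero]
  map_add' φ ψ := by simp [iterate_map_add, mul_add, Finset.sum_add_distrib]

theorem constDiffOp_apply {k : ℕ} (c : Fin k → ℂ) (φ : Mero) :
    constDiffOp c φ = ∑ i, polyHom (C (c i)) * D^[i] φ := rfl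

/-- A nontrivial constant-coefficient differential operator maps `1 / (x - α)` to a function with a
pole at `α`. -/
theorem not_regularAt_sum_D_inv (α : ℂ) {k : ℕ} {c : Fin k → ℂ} (hc : c ≠ 0) :
    ¬ RegularAt α (constDiffOp c (polyHom (X - C α))⁻¹) := by
  obtain ⟨i, hi⟩ := Function.ne_iff.1 hc
  let Q : ℂ[X] := ∑ i : Fin k, C (c i * ((-1) ^ (i : ℕ) * (i : ℕ).factorial)) * X ^ (i + 1 : ℕ)
  have hQ : Q.coeff (i + 1) ≠ 0 := by
    have : Q.coeff (i + 1) = c i * ((-1) ^ (i : ℕ) * (i : ℕ).factorial) := by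
      simp only [Q, finsetSum_coeff, coeff_C_mul, coeff_X_pow, add_left_inj]
      rw [Finset.sum_eq_single i]
      · simp
      · intro j _ hj
        rw [if_neg fun hij => hj (Fin.ext hij.symm), mul_zero]
      · simp
    rw [this]
    exact mul_ne_zero hi (mul_ne_zero (pow_ne_zero _ (by simp)) 
      (by exact_mod_cast (i : ℕ).factorial_ne_zero))
  rw [constDiffOp_apply]
  convert not_regularAt_eval₂ α (Q := Q) (by have := le_natDegree_of_ne_zero hQ; omega) using 2
  simp only [Q, eval₂_finsetSum, D_iterate_inv_X_sub_C, eval₂_mul, eval₂_C, eval₂_X_pow,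
    RingHom.comp_apply, map_mul, mul_assoc]

/-! ### Rational functions up to multiplicative differences `ρ(d) / d` -/

/-- The product of the powers `(x - α_q) ^ N(q)`, where `α_q` is a chosen representative of the
class `q` in `ℂ / ℤh`. -/
noncomputable def orbitProd (h : ℂ) (N : (ℂ ⧸ AddSubgroup.zmultiples h) →₀ ℤ) : Mero :=
  N.prod fun q k => polyHom (X - C q.out) ^ k

theorem polyHom_X_sub_C_ne_zero (α : ℂ) : polyHom (X - C α) ≠ 0 :=
  polyHom_ne_zero (X_sub_C_ne_zero α)

theorem orbitProd_add (N N' : (ℂ ⧸ AddSubgroup.zmultiples h) →₀ ℤ) :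
    orbitProd h (N + N') = orbitProd h N * orbitProd h N' :=
  Finsupp.prod_add_index' (fun _ => zpow_zero _)
    fun _ _ _ => zpow_add₀ (polyHom_X_sub_C_ne_zero _) _ _

theorem orbitProd_ne_zero (N : (ℂ ⧸ AddSubgroup.zmultiples h) →₀ ℤ) : orbitProd h N ≠ 0 :=
  Finset.prod_ne_zero_iff.2 fun _ _ => zpow_ne_zero _ (polyHom_X_sub_C_ne_zero _)

/-- The logarithmic derivative of a nonzero product. -/
theorem D_mul_div {φ ψ : Mero} (hφ : φ ≠ 0) (hψ : ψ ≠ 0) :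
    D (φ * ψ) / (φ * ψ) = D φ / φ + D ψ / ψ := by
  rw [Derivation.leibniz, smul_eq_mul, smul_eq_mul]
  field_simp
  ring

theorem D_zpow_div {φ : Mero} (hφ : φ ≠ 0) (k : ℤ) : D (φ ^ k) / φ ^ k = k * (D φ / φ) := by
  rw [Derivation.leibniz_zpow, zsmul_eq_mul, smul_eq_mul, zpow_sub_one₀ hφ]
  field_simp

theorem D_orbitProd_div (N : (ℂ ⧸ AddSubgroup.zmultiples h) →₀ ℤ) :
    D (orbitProd h N) / orbitProd h N =
      N.sum fun q k => (k : Mero) * (polyHom (X - C q.out))⁻¹ := by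
  induction N using Finsupp.induction_linear with
  | zero => simp [orbitProd]
  | add N N' hN hN' =>
    rw [orbitProd_add, D_mul_div (orbitProd_ne_zero _) (orbitProd_ne_zero _), hN, hN',
      Finsupp.sum_add_index' (by simp) (by intros; push_cast; ring)]
  | single q k =>
    rw [orbitProd, Finsupp.prod_single_index (zpow_zero _), Finsupp.sum_single_index (by simp),
      D_zpow_div (polyHom_X_sub_C_ne_zero _), D_polyHom]
    simp

/-- `φ` is, up to a constant and a factor `ρ(d) / d` with `d` rational, a product of linear factors
whose roots lie in pairwise distinct classes modulo `ℤh`. -/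
def HasOrbitForm (h : ℂ) (φ : Mero) : Prop :=
  ∃ c : ℂ, c ≠ 0 ∧ ∃ d : 𝕜, d ≠ 0 ∧ ∃ N : (ℂ ⧸ AddSubgroup.zmultiples h) →₀ ℤ,
    φ = polyHom (C c) * (shift h (algebraMap 𝕜 Mero d) / algebraMap 𝕜 Mero d) * orbitProd h N

namespace HasOrbitForm

variable {φ ψ : Mero}

theorem const {c : ℂ} (hc : c ≠ 0) : HasOrbitForm h (polyHom (C c)) :=
  ⟨c, hc, 1, one_ne_zero, 0, by simp [orbitProd]⟩

theorem shift_div {d : 𝕜} (hd : d ≠ 0) :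
    HasOrbitForm h (shift h (algebraMap 𝕜 Mero d) / algebraMap 𝕜 Mero d) :=
  ⟨1, one_ne_zero, d, hd, 0, by simp [orbitProd]⟩

theorem mul (hφ : HasOrbitForm h φ) (hψ : HasOrbitForm h ψ) : HasOrbitForm h (φ * ψ) := by
  obtain ⟨c, hc, d, hd, N, rfl⟩ := hφ
  obtain ⟨c', hc', d', hd', N', rfl⟩ := hψ
  refine ⟨c * c', mul_ne_zero hc hc', d * d', mul_ne_zero hd hd', N + N', ?_⟩
  rw [orbitProd_add]
  simp only [map_mul]
  ring

theorem inv (hφ : HasOrbitForm h φ) : HasOrbitForm h φ⁻¹ := by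
  obtain ⟨c, hc, d, hd, N, rfl⟩ := hφ
  refine ⟨c⁻¹, inv_ne_zero hc, d⁻¹, inv_ne_zero hd, -N, ?_⟩
  have h1 : orbitProd h (-N) = (orbitProd h N)⁻¹ := by
    refine eq_inv_of_mul_eq_one_left ?_
    rw [← orbitProd_add, neg_add_cancel, orbitProd, Finsupp.prod_zero_index]
  have h2 : polyHom (C c⁻¹) = (polyHom (C c))⁻¹ := by
    refine eq_inv_of_mul_eq_one_left ?_
    rw [← map_mul, ← C_mul, inv_mul_cancel₀ hc, C_1, map_one]
  rw [h1, h2]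
  simp only [map_inv₀, mul_inv, inv_div]
  field_simp

/-- Shifting a root by `h` multiplies the linear factor by some `ρ(d) / d`. -/
theorem X_sub_C_iff (α : ℂ) :
    HasOrbitForm h (polyHom (X - C (α - h))) ↔ HasOrbitForm h (polyHom (X - C α)) := by
  have h1 : polyHom (X - C (α - h)) = shift h (polyHom (X - C α)) := by
    rw [shift_polyHom]
    congr 1
    simp only [sub_comp, X_comp, C_comp, C_sub]
    ring
  have hne := polyHom_X_sub_C_ne_zero α
  have h2 : HasOrbitForm h (shift h (polyHom (X - C α)) / polyHom (X - C α)) := by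
    rw [← algebraMap_algebraMap]
    exact shift_div ((map_ne_zero_iff _ (RatFunc.algebraMap_injective ℂ)).2 (X_sub_C_ne_zero α))
  rw [h1]
  refine ⟨fun h3 => ?_, fun h3 => ?_⟩
  · have h4 := h2.inv.mul h3
    rwa [inv_div, div_mul_cancel₀ _ ((_root_.map_ne_zero _).2 hne)] at h4
  · have h4 := h2.mul h3
    rwa [div_mul_cancel₀ _ hne] at h4

/-- A root can be moved along its orbit to the chosen representative. -/
theorem X_sub_C (α : ℂ) : HasOrbitForm h (polyHom (X - C α)) := by
  let q : ℂ ⧸ AddSubgroup.zmultiples h := α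
  have hq : HasOrbitForm h (polyHom (X - C q.out)) :=
    ⟨1, one_ne_zero, 1, one_ne_zero, Finsupp.single q 1, by
      rw [orbitProd, Finsupp.prod_single_index (zpow_zero _)]; simp⟩
  have hj : ∀ j : ℤ, HasOrbitForm h (polyHom (X - C (q.out + j * h))) := by
    intro j
    induction j using Int.induction_on with
    | zero => simpa using hq
    | succ n ih =>
      rw [← X_sub_C_iff]
      convert ih using 5
      push_cast
      ring
    | pred n ih =>
      rw [← X_sub_C_iff] at ih
      convert ih using 5
      push_cast
      ring
  have hmem : -q.out + α ∈ AddSubgroup.zmultiples h :=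
    QuotientAddGroup.eq.1 (QuotientAddGroup.out_eq' q)
  obtain ⟨j, hj'⟩ := AddSubgroup.mem_zmultiples_iff.1 hmem
  convert hj j using 5
  rw [← zsmul_eq_mul, hj']
  ring

theorem polyHom {p : ℂ[X]} (hp : p ≠ 0) : HasOrbitForm h (polyHom p) := by
  rw [(IsAlgClosed.splits p).eq_prod_roots, map_mul]
  refine (const (leadingCoeff_ne_zero.2 hp)).mul ?_
  induction p.roots using Multiset.induction_on with
  | empty => simpa using const (h := h) one_ne_zero
  | cons α s ih =>
    rw [Multiset.map_cons, Multiset.prod_cons, map_mul]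
    exact (X_sub_C α).mul ih

theorem algebraMap {a : 𝕜} (ha : a ≠ 0) : HasOrbitForm h (algebraMap 𝕜 Mero a) := by
  obtain ⟨p, q, hq, hr⟩ := exists_eq_div a
  rw [hr, div_eq_mul_inv]
  refine (polyHom ?_).mul (polyHom hq).inv
  rintro rfl
  simp [ha] at hr

end HasOrbitForm

theorem out_add_zsmul_eq_out {q q' : ℂ ⧸ AddSubgroup.zmultiples h} {j : ℤ}
    (hq : q.out + j * h = q'.out) : q = q' := by
  rw [← QuotientAddGroup.out_eq' q, ← QuotientAddGroup.out_eq' q', QuotientAddGroup.eq]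
  refine AddSubgroup.mem_zmultiples_iff.2 ⟨j, ?_⟩
  rw [← hq, zsmul_eq_mul]
  ring

/-- If a nontrivial constant-coefficient differential operator maps the logarithmic derivative of
`a` to a difference `ρ(e) - e` of rational functions, then `a` is a constant times `ρ(d) / d`: a
linear factor surviving in the orbit form of `a` would produce a single pole in its orbit. -/
theorem exists_eq_shift_div (hh : h ≠ 0) {a : 𝕜} (ha : a ≠ 0) {k : ℕ} {c : Fin k → ℂ} (hc : c ≠ 0)
    {e : 𝕜} (he : constDiffOp c (D (algebraMap 𝕜 Mero a) / algebraMap 𝕜 Mero a) =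
      shift h (algebraMap 𝕜 Mero e) - algebraMap 𝕜 Mero e) :
    ∃ c₀ : ℂ, c₀ ≠ 0 ∧ ∃ d : 𝕜, d ≠ 0 ∧ algebraMap 𝕜 Mero a =
      polyHom (C c₀) * (shift h (algebraMap 𝕜 Mero d) / algebraMap 𝕜 Mero d) := by
  obtain ⟨c₀, hc₀, d, hd, N, hN⟩ := HasOrbitForm.algebraMap (h := h) ha
  suffices N = 0 by
    refine ⟨c₀, hc₀, d, hd, ?_⟩
    rw [hN, this]
    simp [orbitProd]
  let Λ := constDiffOp c
  have hΛ : ∀ φ, Λ φ = ∑ i, polyHom (C (c i)) * D^[i] φ := constDiffOp_apply c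
  have hΛreg : ∀ {z φ}, RegularAt z φ → RegularAt z (Λ φ) := by
    intro z φ hφ
    rw [hΛ]
    exact RegularAt.sum fun i _ => (RegularAt.polyHom z _).mul (hφ.D_iterate i)
  have hΛshift : ∀ φ, shift h (Λ φ) = Λ (shift h φ) := by
    intro φ
    simp only [hΛ, map_sum, map_mul, shift_D_iterate, shift_polyHom, C_comp]
  have hΛrat : ∀ r : 𝕜, ∃ r', Λ (algebraMap 𝕜 Mero r) = algebraMap 𝕜 Mero r' := by
    intro r
    have hit : ∀ i : ℕ, ∃ r', D^[i] (algebraMap 𝕜 Mero r) = algebraMap 𝕜 Mero r' := by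
      intro i
      induction i with
      | zero => exact ⟨r, rfl⟩
      | succ i ih =>
        obtain ⟨s, hs⟩ := ih
        rw [Function.iterate_succ_apply', hs]
        exact exists_D_eq s
    choose s hs using hit
    refine ⟨∑ i : Fin k, algebraMap ℂ[X] 𝕜 (C (c i)) * s i, ?_⟩
    simp only [hΛ, hs, map_sum, map_mul, algebraMap_algebraMap]
  set A := algebraMap 𝕜 Mero with hA
  have hdA : A d ≠ 0 := (_root_.map_ne_zero _).2 hd
  have hlog : D (A a) / A a = shift h (D (A d) / A d) - D (A d) / A d +
      N.sum fun q n => (n : Mero) * (polyHom (X - C q.out))⁻¹ := by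
    have hconst : polyHom (C c₀) ≠ 0 := polyHom_ne_zero (by simpa using hc₀)
    have hsd : shift h (A d) ≠ 0 := (_root_.map_ne_zero _).2 hdA
    rw [hN, D_mul_div (mul_ne_zero hconst (div_ne_zero hsd hdA)) (orbitProd_ne_zero _),
      D_mul_div hconst (div_ne_zero hsd hdA), D_orbitProd_div, D_polyHom, Derivation.leibniz_div,
      map_div₀, shift_D]
    simp only [derivative_C, map_zero, zero_div, zero_add, smul_eq_mul]
    field_simp
  obtain ⟨u, hu⟩ := exists_D_eq d
  obtain ⟨δ, hδ⟩ := hΛrat (u / d)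
  rw [map_div₀, ← hu] at hδ
  set S : Mero := N.sum fun q n => (n : Mero) * (polyHom (X - C q.out))⁻¹ with hS
  -- The factor `ρ(d) / d` of `a` only changes `e`.
  have hdiff : Λ S = shift h (A (e - δ)) - A (e - δ) := by
    have h1 := congrArg Λ hlog
    rw [map_add, map_sub, ← hΛshift, he, hδ] at h1
    rw [map_sub, map_sub]
    linear_combination -h1
  -- Each summand has its only pole at the representative of its own class.
  have hterm : ∀ (q : ℂ ⧸ AddSubgroup.zmultiples h) {z : ℂ}, z ≠ q.out →
      RegularAt z ((N q : Mero) * (polyHom (X - C q.out))⁻¹) := by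
    intro q z hz
    refine RegularAt.mul ?_ (RegularAt.inv_polyHom ?_)
    · simpa using RegularAt.polyHom z (N q : ℂ[X])
    · simpa [sub_eq_zero] using hz
  ext q₀
  by_contra hq₀
  have hreg : RegularAt q₀.out (Λ S) := by
    rw [hdiff]
    refine regularAt_shift_sub hh fun j hj => ?_
    rw [← hdiff]
    refine hΛreg (RegularAt.sum fun q _ => hterm q fun hq => hj ?_)
    have := out_add_zsmul_eq_out hq
    rw [← this] at hq
    simpa [hh] using hq
  have hrest : RegularAt q₀.out (Λ (∑ q ∈ N.support.erase q₀,
      (N q : Mero) * (polyHom (X - C q.out))⁻¹)) := by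
    refine hΛreg (RegularAt.sum fun q hq => hterm q fun hq' => ?_)
    refine (Finset.mem_erase.1 hq).1 (out_add_zsmul_eq_out (j := 0) ?_).symm
    simpa using hq'
  have hsplit : Λ S = Λ ((N q₀ : Mero) * (polyHom (X - C q₀.out))⁻¹) +
      Λ (∑ q ∈ N.support.erase q₀, (N q : Mero) * (polyHom (X - C q.out))⁻¹) := by
    rw [← map_add, Finset.add_sum_erase _ (fun q => (N q : Mero) * (polyHom (X - C q.out))⁻¹)
      (Finsupp.mem_support_iff.2 hq₀)]
    rfl
  have hpole := hreg.sub hrest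
  rw [hsplit, add_sub_cancel_right, ← zsmul_eq_mul, map_zsmul] at hpole
  refine not_regularAt_sum_D_inv q₀.out hc ?_
  have hN0 : ((N q₀ : ℂ)) ≠ 0 := by exact_mod_cast hq₀
  have h5 := (RegularAt.polyHom q₀.out (C ((N q₀ : ℂ)⁻¹))).mul hpole
  rwa [zsmul_eq_mul, ← map_intCast polyHom, ← mul_assoc, ← map_mul, ← C_eq_intCast, ← C_mul,
    inv_mul_cancel₀ hN0, C_1, map_one, one_mul] at h5

/-! ### Differentially algebraic solutions -/

instance : CharZero Mero :=
  charZero_of_injective_ringHom (f := polyHom.comp C) (polyHom_injective.comp C_injective)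

/-- The hypotheses on `f` force its multiplier `a` to be a constant times `ρ(d) / d`. -/
theorem exists_eq_shift_div_of_isDiffAlgebraic {h : ℂ} (hh : h ≠ 0) {a : 𝕜} (ha : a ≠ 0)
    {f : Mero} (hf0 : f ≠ 0) (hf : shift h f = algebraMap 𝕜 Mero a * f)
    (hda : IsDiffAlgebraic f) :
    ∃ c₀ : ℂ, c₀ ≠ 0 ∧ ∃ d : 𝕜, d ≠ 0 ∧ algebraMap 𝕜 Mero a =
      polyHom (C c₀) * (shift h (algebraMap 𝕜 Mero d) / algebraMap 𝕜 Mero d) := by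
  have : CharZero 𝕜 := charZero_of_injective_ringHom (f := RatFunc.C) RatFunc.C_injective
  have haA : algebraMap 𝕜 Mero a ≠ 0 := (_root_.map_ne_zero _).2 ha
  obtain ⟨m, P, hP, hPf⟩ := hda
  have hdep : ¬ AlgebraicIndependent 𝕜 fun i : Fin (m + 1) => D^[i] f := fun hind =>
    hP ((algebraicIndependent_iff.1 hind) P hPf)
  obtain ⟨k, hk⟩ := not_algebraicIndependent_logDeriv D exists_D_eq hdep
  -- The logarithmic derivative turns the multiplicative equation into an additive one.
  have hlog : shift h (D f / f) = D f / f + D (algebraMap 𝕜 Mero a) / algebraMap 𝕜 Mero a := by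
    rw [map_div₀, shift_D, hf, D_mul_div haA hf0, add_comm]
  have hβ : ∀ i : ℕ, ∃ r, algebraMap 𝕜 Mero r =
      D^[i] (D (algebraMap 𝕜 Mero a) / algebraMap 𝕜 Mero a) := by
    intro i
    induction i with
    | zero =>
      obtain ⟨r, hr⟩ := exists_D_eq a
      exact ⟨r / a, by rw [map_div₀, ← hr, Function.iterate_zero_apply]⟩
    | succ i ih =>
      obtain ⟨r, hr⟩ := ih
      obtain ⟨r', hr'⟩ := exists_D_eq r
      exact ⟨r', by rw [Function.iterate_succ_apply', ← hr, hr']⟩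
  choose β hβ using hβ
  have hz : ∀ i : Fin k, shift h (D^[i] (D f / f)) =
      D^[i] (D f / f) + algebraMap 𝕜 Mero (β i) := by
    intro i
    rw [shift_D_iterate, hlog, iterate_map_add, hβ]
  obtain ⟨c, e, hc, hcinv, hsum⟩ := MvPolynomial.exists_sum_eq_of_translate_eq_self (ratShift h)
    (fun i : Fin k => β i) (MvPolynomial.exists_translate_eq_self (ratShift h) _
      (fun r => (algebraMap_ratShift h r).symm) hz hk)
  have hconst : ∀ i, ∃ v : ℂ, algebraMap 𝕜 Mero (c i) = polyHom (C v) := fun i =>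
    exists_eq_const_of_shift_eq hh (by rw [← algebraMap_ratShift, hcinv])
  choose v hv using hconst
  refine exists_eq_shift_div hh ha (c := v) (e := -e) ?_ ?_
  · rintro rfl
    refine hc (funext fun i => (algebraMap 𝕜 Mero).injective ?_)
    rw [hv]
    simp
  · have h1 := congrArg (algebraMap 𝕜 Mero) hsum
    simp only [map_sum, map_mul, map_sub, hv, hβ, algebraMap_ratShift] at h1
    rw [constDiffOp_apply, h1, map_neg, map_neg]
    ring

/-! ### Membership in `R_{h,exp}` -/

theorem polyHom_C_mem_periodic (h v : ℂ) : polyHom (C v) ∈ periodic h := by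
  change shift h (polyHom (C v)) = polyHom (C v)
  rw [shift_polyHom, C_comp]

theorem mem_periodicRat_of_mem_periodic {h : ℂ} {φ : Mero} (hφ : φ ∈ periodic h) :
    φ ∈ periodicRat h := by
  refine Subfield.subset_closure (Or.inl (Set.mem_iUnion₂.2 ⟨1, le_rfl, ?_⟩))
  simpa using hφ

theorem polyHom_mem_periodicRat (h : ℂ) (p : ℂ[X]) : polyHom p ∈ periodicRat h := by
  induction p using Polynomial.induction_on with
  | C v => exact mem_periodicRat_of_mem_periodic (polyHom_C_mem_periodic h v)
  | add p q hp hq => rw [map_add]; exact add_mem hp hq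
  | monomial n v ih =>
    have hX : polyHom X = xM :=
      Subtype.ext (Germ.coe_eq.2 (Eventually.of_forall fun _ => eval_X))
    rw [pow_succ, ← mul_assoc, map_mul, hX]
    exact mul_mem ih (Subfield.subset_closure (Or.inr rfl))

theorem algebraMap_mem_periodicRat (h : ℂ) (r : 𝕜) : algebraMap 𝕜 Mero r ∈ periodicRat h := by
  obtain ⟨p, q, -, hr⟩ := exists_eq_div r
  rw [hr]
  exact div_mem (polyHom_mem_periodicRat h p) (polyHom_mem_periodicRat h q)

theorem mul_expM_mem_Rexp {h : ℂ} {φ : Mero} (hφ : φ ∈ periodicRat h) (c : ℂ) :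
    φ * expM c ∈ Rexp h :=
  Submodule.smul_mem (Submodule.span (periodicRat h) (Set.range expM)) ⟨φ, hφ⟩
    (Submodule.subset_span ⟨c, rfl⟩)

end MeroShift

theorem mainTheorem4 (h : ℂ) (hh : h ≠ 0) (a : RatFunc ℂ) (ha : a ≠ 0)
    (f : MeroShift.Mero)
    (hf : MeroShift.shift h f = algebraMap (RatFunc ℂ) MeroShift.Mero a * f)
    (hda : MeroShift.IsDiffAlgebraic f) :
    (∃ c₁ ∈ MeroShift.periodic h, ∃ (d : RatFunc ℂ) (c' : ℂ),
      f = c₁ * algebraMap (RatFunc ℂ) MeroShift.Mero d * MeroShift.expM c') ∧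
    f ∈ MeroShift.Rexp h := by
  open MeroShift in
  have key : ∃ c₁ ∈ periodic h, ∃ (d : RatFunc ℂ) (c' : ℂ),
      f = c₁ * algebraMap (RatFunc ℂ) Mero d * expM c' := by
    rcases eq_or_ne f 0 with rfl | hf0
    · exact ⟨0, zero_mem _, 0, 0, by simp⟩
    obtain ⟨c₀, hc₀, d, hd, had⟩ := exists_eq_shift_div_of_isDiffAlgebraic hh ha hf0 hf hda
    have hdA : algebraMap (RatFunc ℂ) Mero d ≠ 0 := (map_ne_zero _).2 hd
    have hsd : shift h (algebraMap (RatFunc ℂ) Mero d) ≠ 0 := (map_ne_zero _).2 hdA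
    have hcA : polyHom (Polynomial.C c₀) ≠ 0 := polyHom_ne_zero (by simpa using hc₀)
    -- The exponential `exp (c' x)` with `exp (c' h) = c₀` absorbs the constant.
    have hexp : Complex.exp (Complex.log c₀ / h * h) = c₀ := by
      rw [div_mul_cancel₀ _ hh, Complex.exp_log hc₀]
    have hE := expM_ne_zero (Complex.log c₀ / h)
    refine ⟨f / (algebraMap (RatFunc ℂ) Mero d * expM (Complex.log c₀ / h)), ?_, d,
      Complex.log c₀ / h, ?_⟩
    · change shift h _ = _
      rw [map_div₀, map_mul, hf, had, shift_expM, hexp, RingHom.id_apply]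
      field_simp
    · field_simp
  refine ⟨key, ?_⟩
  obtain ⟨c₁, hc₁, d, c', rfl⟩ := key
  exact MeroShift.mul_expM_mem_Rexp (mul_mem (MeroShift.mem_periodicRat_of_mem_periodic hc₁)
    (MeroShift.algebraMap_mem_periodicRat h d)) c'
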